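/- Let $X$ be a real or complex Banach space with $\dim X\ge 2$ (possibly infinite), let $\mathbb K\in\{\mathbb R,\mathbb C\}$ be its scalar field, and let $A=B(X)$ be the $\mathbb K$-algebra of bounded linear operators on $X$, with center $Z(A)$ and commutator $[x,y]=xy-yx$. Let $\{L_k\}_{k\ge 0}$ be a Lie higher derivation on $A$, that is, a sequence of $\mathbb K$-linear maps $L_k:A\to A$ (not assumed continuous) with $L_0=\mathrm{id}_A$ and \[ L_k([x,y])=\sum_{i+j=k}[L_i(x),L_j(y)]\qquad (x,y\in A,\ k\ge 0). \] Then $\{L_k\}$ is proper: there are a higher derivation $\{D_k\}_{k\ge 0}$ on $A$, that is, a sequence of $\mathbb K$-linear maps $D_k:A\to A$ with $D_0=\mathrm{id}_A$ and $D_k(xy)=\sum_{i+j=k}D_i(x)D_j(y)$ for all $x,y\in A$ and $k\ge 0$, and $\mathbb K$-linear maps $\tau_k:A\to A$ $(k\ge 1)$ with $\tau_k(A)\subseteq Z(A)$ and $\tau_k([x,y])=0$ for all $x,y\in A$, such that $L_k=D_k+\tau_k$ for every $k\ge 1$. -/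

import Mathlib

/-- A higher derivation on an `R`-algebra `A`: a sequence of `R`-linear maps `D 0, D 1, …` with
`D 0 = id` and `D k (x * y) = ∑_{i + j = k} D i x * D j y`. -/
structure IsHigherDerivation {R A : Type*} [CommRing R] [Ring A] [Algebra R A]
    (D : ℕ → A →ₗ[R] A) : Prop where
  zero_eq_id : D 0 = LinearMap.id
  map_mul : ∀ (k : ℕ) (x y : A),
    D k (x * y) = ∑ p ∈ Finset.HasAntidiagonal.antidiagonal k, D p.1 x * D p.2 y

/-- A Lie higher derivation on an `R`-algebra `A`: a sequence of `R`-linear maps `L 0, L 1, …` with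
`L 0 = id` and `L k [x, y] = ∑_{i + j = k} [L i x, L j y]`, where `⁅x, y⁆ = x * y - y * x`. -/
structure IsLieHigherDerivation {R A : Type*} [CommRing R] [Ring A] [Algebra R A]
    (L : ℕ → A →ₗ[R] A) : Prop where
  zero_eq_id : L 0 = LinearMap.id
  map_lie : ∀ (k : ℕ) (x y : A),
    L k ⁅x, y⁆ = ∑ p ∈ Finset.HasAntidiagonal.antidiagonal k, ⁅L p.1 x, L p.2 y⁆

/-- The sequence `L` is proper: `L = D + τ` with `D` a higher derivation and `τ 1, τ 2, …` linear
maps with values in the center that vanish at commutators (the index `0` carries no `τ`, since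
`L 0` and `D 0` are both the identity). -/
def IsProperLieHigherDerivation {R A : Type*} [CommRing R] [Ring A] [Algebra R A]
    (L : ℕ → A →ₗ[R] A) : Prop :=
  ∃ D τ : ℕ → A →ₗ[R] A, IsHigherDerivation D ∧
    L 0 = D 0 ∧
    (∀ k, 1 ≤ k → L k = D k + τ k) ∧
    (∀ k, 1 ≤ k → ∀ x : A, τ k x ∈ Subalgebra.center R A) ∧
    (∀ k, 1 ≤ k → ∀ x y : A, τ k ⁅x, y⁆ = 0)

/-- The Lie higher derivation property of an `R`-algebra `A`: every Lie higher derivation on `A`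
is proper. -/
def HasLHDProperty (R A : Type*) [CommRing R] [Ring A] [Algebra R A] : Prop :=
  ∀ L : ℕ → A →ₗ[R] A, IsLieHigherDerivation L → IsProperLieHigherDerivation L

/-! Write `L(t) = ∑ L_k t^k`. Its logarithmic derivative `l = t L' L⁻¹` has Lie derivations as
coefficients, so it suffices to split ordinary Lie derivations as `l_n = δ_n + τ_n`, derivation plus
central map. Solving `t D' = δ D` gives a higher derivation `D`, and by induction `L_n - D_n` is
central and kills commutators (`hasLHDProperty_of_lieDerivation_standard`).

The splitting (`lieDerivation_standard`) uses a rank-one idempotent `p`: `pAp` is the scalars and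
`A` acts faithfully on `Ap`. An inner derivation is subtracted to make `L p` scalar; then a
scalar-valued map is removed, the product rule is checked on `Ap`, and faithfulness extends it to
`A`. -/

/-! ### Lie derivations and minimal idempotents -/

section MinimalIdempotent

variable {K A : Type*} [Field K] [Ring A] [Algebra K A]

/-- The Peirce decomposition with respect to an element `p`. -/
theorem peirce_decomposition (p a : A) :
    a = p * a * p + (p * a - p * a * p) + (a * p - p * a * p)
      + (a - p * a - a * p + p * a * p) := by
  abel

/-- A Lie derivation which is central at a minimal idempotent `p` of an algebra on which `A * p` is
faithful is the sum of a derivation and a map to the scalars. -/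
theorem lieDerivation_standard_of_map_idempotent (h2 : (2 : K) ≠ 0) {p : A} {φ : A →ₗ[K] K}
    (hp : p * p = p) (hφ : ∀ a, p * a * p = φ a • p) (hφp : φ p = 1)
    (faith : ∀ s : A, (∀ a, s * (a * p) = 0) → s = 0) (L : A →ₗ[K] A)
    (hL : ∀ x y, L ⁅x, y⁆ = ⁅L x, y⁆ + ⁅x, L y⁆) (c : K) (hLp : L p = c • 1) :
    ∃ d τ : A →ₗ[K] A, (∀ x y, d (x * y) = d x * y + x * d y) ∧
      (∀ x, τ x ∈ Subalgebra.center K A) ∧ L = d + τ := by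
  simp only [Ring.lie_def] at hL
  have two : ∀ x : A, x + x = 0 → x = 0 := by
    intro x hx
    rw [← two_smul K] at hx
    exact (smul_eq_zero.1 hx).resolve_left h2
  have φz : ∀ a, p * a * p = 0 → φ a = 0 := by
    intro a ha
    rw [hφ] at ha
    simpa [hφp] using congrArg φ ha
  have hpp : ∀ a, p * (p * a) = p * a := fun a => by rw [← mul_assoc, hp]
  have hpL : ∀ x, L (p * x - x * p) = p * L x - L x * p := by
    intro x; rw [hL, hLp]; simp
  -- the action of `L` on the Peirce components
  have L21 : ∀ x, p * x = 0 → x * p = x → p * L x = 0 ∧ L x * p = L x := by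
    intro x h1 h3
    have h := hpL x
    rw [h1, h3, zero_sub, map_neg] at h
    have h4 : p * L x * p = 0 := by
      have := congrArg (· * p) h
      simp only [neg_mul, sub_mul, mul_assoc, hp] at this
      rw [mul_assoc]
      simpa using (congrArg (· + L x * p) this).symm
    have h5 : p * L x = 0 := by
      apply two
      have := congrArg (p * ·) h
      simp only [mul_neg, mul_sub, hpp, ← mul_assoc, h4] at this
      rw [sub_zero] at this
      nth_rewrite 1 [← this]; simp
    refine ⟨h5, ?_⟩
    rw [h5, zero_sub] at h
    exact (neg_injective h).symm
  have L12 : ∀ x, p * x = x → x * p = 0 → p * L x = L x ∧ L x * p = 0 := by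
    intro x h1 h3
    have h := hpL x
    rw [h1, h3, sub_zero] at h
    have h4 : p * L x * p = 0 := by
      have := congrArg (p * ·) h
      simp only [mul_sub, hpp, ← mul_assoc] at this
      exact sub_eq_self.1 this.symm
    have h5 : L x * p = 0 := by
      apply two
      have := congrArg (· * p) h
      simp only [sub_mul, h4] at this
      rw [mul_assoc, hp, zero_sub] at this
      nth_rewrite 1 [this]; simp
    refine ⟨?_, h5⟩
    rw [h5, sub_zero] at h
    exact h.symm
  have Ldiag : ∀ x, p * x = 0 → x * p = 0 → p * L x = L x * p := by
    intro x h1 h3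
    have h := hpL x
    rw [h1, h3, sub_zero, map_zero] at h
    exact (sub_eq_zero.1 h.symm)
  let Q : A →ₗ[K] A := LinearMap.id - LinearMap.mulLeft K p - LinearMap.mulRight K p
    + (LinearMap.mulRight K p).comp (LinearMap.mulLeft K p)
  have hQ : ∀ x, Q x = x - p * x - x * p + p * x * p := fun x => rfl
  -- `Q` projects onto the block `(1 - p)A(1 - p)`. This `t` makes `L - t • 1` kill `p` and map that
  -- block into itself.
  let t : A →ₗ[K] K := c • φ + φ.comp (L.comp Q)
  have ht : ∀ x, t x = c * φ x + φ (L (Q x)) := fun x => rfl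
  let τ : A →ₗ[K] A := t.smulRight 1
  have hτ : ∀ x, τ x = t x • 1 := fun x => rfl
  let d : A →ₗ[K] A := L - τ
  have hd : ∀ x, d x = L x - t x • 1 := fun x => rfl
  have dp : d p = 0 := by
    rw [hd, ht, hQ, hLp, hφp]; simp [hp]
  have t12 : ∀ x, p * x = x → x * p = 0 → t x = 0 := by
    intro x h1 h3
    rw [ht, hQ, φz x (by rw [h1, h3])]; simp [h1, h3]
  have t21 : ∀ x, p * x = 0 → x * p = x → t x = 0 := by
    intro x h1 h3
    rw [ht, hQ, φz x (by rw [h1, zero_mul])]; simp [h1, h3]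
  have t22 : ∀ x, p * x = 0 → x * p = 0 → t x = φ (L x) := by
    intro x h1 h3
    rw [ht, hQ, φz x (by rw [h1, zero_mul])]; simp [h1, h3]
  have d12 : ∀ x, p * x = x → x * p = 0 → p * d x = d x ∧ d x * p = 0 := by
    intro x h1 h3
    rw [hd, t12 x h1 h3, zero_smul, sub_zero]; exact L12 x h1 h3
  have d21 : ∀ x, p * x = 0 → x * p = x → p * d x = 0 ∧ d x * p = d x := by
    intro x h1 h3
    rw [hd, t21 x h1 h3, zero_smul, sub_zero]; exact L21 x h1 h3
  have d22 : ∀ x, p * x = 0 → x * p = 0 → p * d x = 0 ∧ d x * p = 0 := by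
    intro x h1 h3
    have h := Ldiag x h1 h3
    have h4 : p * L x = φ (L x) • p := by
      rw [← hφ, mul_assoc, ← h, hpp]
    rw [hd, t22 x h1 h3]
    constructor
    · rw [mul_sub, h4]; simp
    · rw [sub_mul, ← h, h4]; simp
  have dL : ∀ x y, d (x * y - y * x)
      = d x * y - y * d x + (x * d y - d y * x) - t (x * y - y * x) • 1 := by
    intro x y
    simp only [hd (x * y - y * x), hL, hd x, hd y, sub_mul, mul_sub, smul_mul_assoc,
      mul_smul_comm, one_mul, mul_one]
    abel
  have d11 : ∀ a, d (p * a * p) = 0 := fun a => by rw [hφ, map_smul, dp, smul_zero]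
  -- the block `22` acts on the block `21`
  have m2221 : ∀ a b, p * a = 0 → a * p = 0 → p * b = 0 → b * p = b →
      d (a * b) = d a * b + a * d b := by
    intro a b h1 h3 h4 h5
    have ba : b * a = 0 := by rw [← h5, mul_assoc, h1, mul_zero]
    have bda : b * d a = 0 := by rw [← h5, mul_assoc, (d22 a h1 h3).1, mul_zero]
    have dba : d b * a = 0 := by rw [← (d21 b h4 h5).2, mul_assoc, h1, mul_zero]
    have h := dL a b
    rw [ba, bda, dba, sub_zero, sub_zero, sub_zero, t21, zero_smul, sub_zero] at h
    · exact h
    · rw [← mul_assoc, h1, zero_mul]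
    · rw [mul_assoc, h5]
  -- the blocks `12` and `21`
  have key : ∀ x y, p * x = x → x * p = 0 → p * y = 0 → y * p = y →
      d x * y + x * d y = t (x * y - y * x) • p ∧
      d (y * x) = y * d x + d y * x + t (x * y - y * x) • (1 - p) := by
    intro x y h1 h3 h4 h5
    have h := dL x y
    have e11 : x * y = p * (x * y) * p := by rw [mul_assoc, mul_assoc, h5, ← mul_assoc, h1]
    rw [map_sub d, e11, d11, ← e11, zero_sub] at h
    obtain ⟨u1, u2⟩ := d12 x h1 h3
    obtain ⟨v1, v2⟩ := d21 y h4 h5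
    obtain ⟨w1, w2⟩ := d22 (y * x) (by rw [← mul_assoc, h4, zero_mul])
      (by rw [mul_assoc, h3, mul_zero])
    have hA : d x * y + x * d y = t (x * y - y * x) • p := by
      have := congrArg (p * ·) h
      simp only [mul_neg, w1, mul_sub, mul_add, ← mul_assoc, u1, v1, h1, h4, zero_mul,
        mul_smul_comm, mul_one, neg_zero, sub_zero] at this
      exact (sub_eq_zero.1 this.symm)
    refine ⟨hA, ?_⟩
    have h6 : d (y * x) = -(d x * y + x * d y) + (y * d x + d y * x)
        + t (x * y - y * x) • 1 := by
      rw [← neg_inj, h]; abel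
    rw [h6, hA, smul_sub]; abel
  -- Computing `d (y * x * y)` by `m2221`, and again from `x * y` being a multiple of `p`, gives `2
  -- s y = 0` for `s` the value of `t`.
  have tcomm : ∀ x y, p * x = x → x * p = 0 → p * y = 0 → y * p = y →
      t (x * y - y * x) • p = 0 := by
    intro x y h1 h3 h4 h5
    obtain ⟨k1, k2⟩ := key x y h1 h3 h4 h5
    generalize t (x * y - y * x) = s at k1 k2 ⊢
    obtain ⟨v1, v2⟩ := d21 y h4 h5
    have h := m2221 (y * x) y (by rw [← mul_assoc, h4, zero_mul])
      (by rw [mul_assoc, h3, mul_zero]) h4 h5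
    obtain ⟨r, e11⟩ : ∃ r : K, x * y = r • p :=
      ⟨φ (x * y), by rw [← hφ, mul_assoc, mul_assoc, h5, ← mul_assoc, h1]⟩
    have e : d (y * x * y) = d y * (x * y) := by
      rw [mul_assoc, e11, mul_smul_comm, h5, map_smul, mul_smul_comm, v2]
    rw [e, k2, add_mul, add_mul, smul_mul_assoc, sub_mul, one_mul, h4, sub_zero] at h
    have h7 : y * (d x * y + x * d y) + s • y = 0 := by
      have : d y * (x * y) = d y * (x * y) + (y * (d x * y + x * d y) + s • y) := by
        nth_rewrite 1 [h]; simp only [mul_add, mul_assoc]; abel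
      simpa using this
    rw [k1, mul_smul_comm, h5] at h7
    rcases smul_eq_zero.1 (two _ h7) with h8 | h8
    · rw [h8, zero_smul]
    · have hz : s • p = 0 := by rw [← k1, h8]; simp
      exact hz
  -- Peirce components of an element
  have c12 : ∀ a, p * (p * a - p * a * p) = p * a - p * a * p ∧ (p * a - p * a * p) * p = 0 :=
    fun a => by simp [mul_sub, sub_mul, mul_assoc, hp, hpp]
  have c21 : ∀ a, p * (a * p - p * a * p) = 0 ∧ (a * p - p * a * p) * p = a * p - p * a * p :=
    fun a => by simp [mul_sub, sub_mul, mul_assoc, hp, hpp]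
  have c22 : ∀ a, p * (a - p * a - a * p + p * a * p) = 0 ∧
      (a - p * a - a * p + p * a * p) * p = 0 :=
    fun a => by simp [mul_sub, sub_mul, mul_add, add_mul, mul_assoc, hp, hpp]
  have colp : ∀ a, d (a * p) = d a * p := by
    intro a
    have e : a * p = p * a * p + (a * p - p * a * p) := by abel
    rw [e, map_add, d11, zero_add]
    nth_rewrite 3 [peirce_decomposition p a]
    rw [map_add, map_add, map_add, d11, add_mul, add_mul, add_mul, zero_mul,
      (d12 _ (c12 a).1 (c12 a).2).2, (d21 _ (c21 a).1 (c21 a).2).2,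
      (d22 _ (c22 a).1 (c22 a).2).2]
    abel
  have col21 : ∀ a b, p * b = 0 → b * p = b → d (a * b) = d a * b + a * d b := by
    intro a b h4 h5
    obtain ⟨v1, v2⟩ := d21 b h4 h5
    have z : ∀ u w : A, u * p = u → p * w = 0 → u * w = 0 := by
      intro u w h6 h7; rw [← h6, mul_assoc, h7, mul_zero]
    have e11 : d (p * a * p * b) = d (p * a * p) * b + p * a * p * d b := by
      rw [d11, mul_assoc _ p, h4, mul_assoc _ p, v1]; simp
    have e12 := (key _ b (c12 a).1 (c12 a).2 h4 h5).1
    rw [tcomm _ b (c12 a).1 (c12 a).2 h4 h5] at e12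
    have e12' : d ((p * a - p * a * p) * b) = 0 := by
      have : ∀ u, p * u = u → u * b = p * (u * b) * p := by
        intro u hu
        rw [mul_assoc p, mul_assoc u, h5, ← mul_assoc, hu]
      rw [this _ (c12 a).1, d11]
    obtain ⟨w1, w2⟩ := d21 _ (c21 a).1 (c21 a).2
    have e21 : d ((a * p - p * a * p) * b)
        = d (a * p - p * a * p) * b + (a * p - p * a * p) * d b := by
      rw [z _ _ (c21 a).2 h4, z _ _ w2 h4, z _ _ (c21 a).2 v1]; simp
    have e22 := m2221 _ b (c22 a).1 (c22 a).2 h4 h5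
    have e : ∀ u v : A, d (u * b) = d u * b + u * d b → d (v * b) = d v * b + v * d b →
        d ((u + v) * b) = d (u + v) * b + (u + v) * d b := by
      intro u v hu hv
      rw [add_mul, map_add, hu, hv, map_add, add_mul, add_mul]; abel
    rw [peirce_decomposition p a]
    exact e _ _ (e _ _ (e _ _ e11 (e12'.trans e12.symm)) e21) e22
  have col : ∀ a b, b * p = b → d (a * b) = d a * b + a * d b := by
    intro a b hb
    have e : b = φ b • p + (b - p * b) := by
      rw [← hφ, mul_assoc, hb]; abel
    have h := col21 a (b - p * b) (by rw [mul_sub, hpp, sub_self])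
      (by rw [sub_mul, mul_assoc, hb])
    rw [e, mul_add, map_add, h, mul_smul_comm, map_smul, colp, map_add, map_smul, dp]
    simp only [mul_add, mul_smul_comm, smul_zero, zero_add]
    abel
  refine ⟨d, τ, ?_, ?_, by simp [d]⟩
  · intro x y
    -- Expand `d (x * y * (b * p))` under both bracketings; `col` covers every product involved.
    refine sub_eq_zero.1 (faith _ fun b => ?_)
    have hb : b * p * p = b * p := by rw [mul_assoc, hp]
    have h1 := col (x * y) (b * p) hb
    have h3 := col y (b * p) hb
    have h4 := col x (y * (b * p)) (by rw [mul_assoc, hb])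
    rw [← mul_assoc, h1, h3] at h4
    rw [sub_mul, add_mul, sub_eq_zero]
    have h5 : d (x * y) * (b * p) = d x * (y * (b * p)) + x * (d y * (b * p) + y * d (b * p))
        - x * y * d (b * p) := by rw [← h4]; abel
    rw [h5]; noncomm_ring
  · intro x
    rw [hτ]
    exact Subalgebra.smul_mem _ (Subalgebra.one_mem _) _

/-- Every Lie derivation of an algebra with a minimal idempotent `p` such that `A * p` is faithful
is the sum of a derivation and a map to the center. -/
theorem lieDerivation_standard (h2 : (2 : K) ≠ 0) {p : A} {φ : A →ₗ[K] K}
    (hp : p * p = p) (hφ : ∀ a, p * a * p = φ a • p) (hφp : φ p = 1)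
    (faith : ∀ s : A, (∀ a, s * (a * p) = 0) → s = 0) (L : A →ₗ[K] A)
    (hL : ∀ x y, L ⁅x, y⁆ = ⁅L x, y⁆ + ⁅x, L y⁆) :
    ∃ d τ : A →ₗ[K] A, (∀ x y, d (x * y) = d x * y + x * d y) ∧
      (∀ x, τ x ∈ Subalgebra.center K A) ∧ L = d + τ := by
  have hpp : ∀ a, p * (p * a) = p * a := fun a => by rw [← mul_assoc, hp]
  set u := L p with hu
  have corner : u - p * u - u * p + p * u * p = φ u • (1 - p) := by
    refine sub_eq_zero.1 (faith _ fun b => ?_)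
    -- On `w = (1 - p)bp` the bracket with `p` is `-w`, so in the `(1 - p)Ap` component the `L w`
    -- terms cancel, leaving `(1 - p)u w = φ u • w`.
    have h := hL p (b * p - p * b * p)
    have e : ⁅p, b * p - p * b * p⁆ = -(b * p - p * b * p) := by
      simp [Ring.lie_def, mul_sub, sub_mul, mul_assoc, hp, hpp]
    rw [e, map_neg] at h
    simp only [Ring.lie_def, ← hu] at h
    have h' := congrArg (fun z => z * p - p * z * p) h
    have hq : φ u • p = p * (u * p) := by rw [← hφ, mul_assoc]
    have hb : (1 - p) * (b * p) * (φ u • p) = (1 - p) * (b * (p * (u * p))) := by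
      rw [hq, mul_assoc, mul_assoc, hpp]
    rw [mul_smul_comm, mul_assoc, mul_assoc, hp] at hb
    rw [sub_mul, smul_mul_assoc, hb]
    simp only [mul_sub, sub_mul, add_mul, mul_add, neg_mul, mul_neg, mul_assoc, hp, hpp,
      one_mul] at h' ⊢
    rw [← sub_eq_zero] at h'
    rw [← neg_eq_zero, ← h']
    abel
  -- Bracketing with `a` reproduces the off-diagonal blocks of `u` at `p`.
  let a := p * u - u * p
  let I : A →ₗ[K] A := LinearMap.mulRight K a - LinearMap.mulLeft K a
  have hI : ∀ x, I x = x * a - a * x := fun x => rfl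
  have hIp : (L - I) p = φ u • 1 := by
    have : (L - I) p = p * u * p + (u - p * u - u * p + p * u * p) := by
      rw [LinearMap.sub_apply, hI, ← hu]
      simp only [a, mul_sub, sub_mul, mul_assoc, hp, hpp]
      abel
    rw [this, corner, hφ, smul_sub]; abel
  obtain ⟨d, τ, hd, hτ, h⟩ := lieDerivation_standard_of_map_idempotent h2 hp hφ hφp faith (L - I)
    (by
      intro x y
      rw [LinearMap.sub_apply L I, hL, LinearMap.sub_apply L I, LinearMap.sub_apply L I, hI, hI, hI]
      simp only [Ring.lie_def]
      noncomm_ring) (φ u) hIp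
  refine ⟨d + I, τ, ?_, hτ, ?_⟩
  · intro x y
    simp only [LinearMap.add_apply, hd, hI]
    noncomm_ring
  · rw [sub_eq_iff_eq_add.1 h]; abel

end MinimalIdempotent

/-! ### Logarithmic derivatives of sequences -/

section LogarithmicDerivative

variable {K A : Type*} [Field K] [Ring A] [Algebra K A]

/-- The sequence `l` with `n • L n = ∑_{a + b = n} l a ∘ L b`, for `L 0 = id`. -/
noncomputable def logDerivSeq (L : ℕ → A →ₗ[K] A) : ℕ → A →ₗ[K] A
  | n => (n : K) • L n - ∑ i : Fin n, (logDerivSeq L i).comp (L (n - i))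

/-- The sequence `D` with `D 0 = id` and `n • D n = ∑_{a + b = n} l a ∘ D b`, for `l 0 = 0`. -/
noncomputable def expSeq (l : ℕ → A →ₗ[K] A) : ℕ → A →ₗ[K] A
  | 0 => LinearMap.id
  | n + 1 => ((n : K) + 1)⁻¹ • ∑ i : Fin (n + 1), (l (n + 1 - i)).comp (expSeq l i)

/-- `l` is the logarithmic derivative of `L`, as sequences of coefficients of power series. -/
structure IsLogDerivSeq (l L : ℕ → A →ₗ[K] A) : Prop where
  zero_eq_id : L 0 = LinearMap.id
  zero_eq_zero : l 0 = 0
  smul_eq_sum : ∀ (n : ℕ) (x : A),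
    (n : K) • L n x = ∑ q ∈ Finset.HasAntidiagonal.antidiagonal n, l q.1 (L q.2 x)

theorem isLogDerivSeq_logDerivSeq {L : ℕ → A →ₗ[K] A} (h0 : L 0 = LinearMap.id) :
    IsLogDerivSeq (logDerivSeq L) L where
  zero_eq_id := h0
  zero_eq_zero := by rw [logDerivSeq]; simp
  smul_eq_sum n x := by
    have e : logDerivSeq L n = (n : K) • L n
        - ∑ i : Fin n, (logDerivSeq L i).comp (L (n - i)) := by rw [logDerivSeq]
    rw [Finset.Nat.sum_antidiagonal_eq_sum_range_succ (fun a b => logDerivSeq L a (L b x)),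
      Finset.sum_range_succ, Nat.sub_self, h0]
    simp [e, Finset.sum_range]

theorem isLogDerivSeq_expSeq [CharZero K] {l : ℕ → A →ₗ[K] A} (h0 : l 0 = 0) :
    IsLogDerivSeq l (expSeq l) where
  zero_eq_id := by rw [expSeq]
  zero_eq_zero := h0
  smul_eq_sum n x := by
    rw [← Finset.Nat.sum_antidiagonal_swap]
    simp only [Prod.fst_swap, Prod.snd_swap]
    rw [Finset.Nat.sum_antidiagonal_eq_sum_range_succ (fun a b => l b (expSeq l a x)),
      Finset.sum_range_succ, Nat.sub_self, h0, LinearMap.zero_apply, add_zero]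
    cases n with
    | zero => simp
    | succ n =>
      have : (n : K) + 1 ≠ 0 := Nat.cast_add_one_ne_zero n
      rw [expSeq]
      simp [Finset.sum_range, smul_smul, this]

namespace IsLogDerivSeq

variable {l L : ℕ → A →ₗ[K] A}

/-- Product rule for `t d/dt`: the factor `n` splits as `q.1 + q.2`, and each half is absorbed by
the recursion for `L`. -/
theorem smul_sum_bilin (h : IsLogDerivSeq l L) (B : A →ₗ[K] A →ₗ[K] A) (n : ℕ) (x y : A) :
    (n : K) • ∑ q ∈ Finset.HasAntidiagonal.antidiagonal n, B (L q.1 x) (L q.2 y) =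
      ∑ q ∈ Finset.HasAntidiagonal.antidiagonal n,
        ∑ r ∈ Finset.HasAntidiagonal.antidiagonal q.2,
          (B (l q.1 (L r.1 x)) (L r.2 y) + B (L r.1 x) (l q.1 (L r.2 y))) := by
  have e1 : ∀ q ∈ Finset.HasAntidiagonal.antidiagonal n,
      (n : K) • B (L q.1 x) (L q.2 y) =
      ∑ r ∈ Finset.HasAntidiagonal.antidiagonal q.1, B (l r.1 (L r.2 x)) (L q.2 y) +
      ∑ r ∈ Finset.HasAntidiagonal.antidiagonal q.2, B (L q.1 x) (l r.1 (L r.2 y)) := by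
    intro q hq
    rw [← Finset.HasAntidiagonal.mem_antidiagonal.1 hq, Nat.cast_add, add_smul, ← LinearMap.map_smul₂,
      ← map_smul (B _), h.smul_eq_sum, h.smul_eq_sum, map_sum, map_sum, LinearMap.sum_apply]
  rw [Finset.smul_sum, Finset.sum_congr rfl e1, Finset.sum_add_distrib]
  simp only [Finset.sum_add_distrib]
  congr 1
  · rw [Finset.sum_sigma', Finset.sum_sigma']
    refine Finset.sum_bij' (fun q _ => ⟨(q.2.1, q.2.2 + q.1.2), (q.2.2, q.1.2)⟩)
      (fun q _ => ⟨(q.1.1 + q.2.1, q.2.2), (q.1.1, q.2.1)⟩) ?_ ?_ ?_ ?_ ?_ <;>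
    · rintro ⟨⟨a, b⟩, ⟨c, d⟩⟩ hq
      simp only [Finset.mem_sigma, Finset.HasAntidiagonal.mem_antidiagonal] at hq ⊢
      try grind
  · rw [Finset.sum_sigma', Finset.sum_sigma']
    refine Finset.sum_bij' (fun q _ => ⟨(q.2.1, q.1.1 + q.2.2), (q.1.1, q.2.2)⟩)
      (fun q _ => ⟨(q.2.1, q.1.1 + q.2.2), (q.1.1, q.2.2)⟩) ?_ ?_ ?_ ?_ ?_ <;>
    · rintro ⟨⟨a, b⟩, ⟨c, d⟩⟩ hq
      simp only [Finset.mem_sigma, Finset.HasAntidiagonal.mem_antidiagonal] at hq ⊢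
      try grind

/-- If the Leibniz rules hold below `n`, the defects of the Leibniz rules at `n` are
proportional. -/
theorem smul_leibniz_defect (h : IsLogDerivSeq l L) (B : A →ₗ[K] A →ₗ[K] A) (n : ℕ)
    (hl : ∀ m < n, ∀ x y, l m (B x y) = B (l m x) y + B x (l m y))
    (hL : ∀ m < n, ∀ x y, L m (B x y) =
      ∑ q ∈ Finset.HasAntidiagonal.antidiagonal m, B (L q.1 x) (L q.2 y)) (x y : A) :
    (n : K) • (L n (B x y)
        - ∑ q ∈ Finset.HasAntidiagonal.antidiagonal n, B (L q.1 x) (L q.2 y)) =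
      l n (B x y) - (B (l n x) y + B x (l n y)) := by
  rw [smul_sub, h.smul_sum_bilin, h.smul_eq_sum, ← Finset.sum_sub_distrib,
    Finset.sum_eq_single (n, 0)]
  · simp [h.zero_eq_id]
  · rintro ⟨a, b⟩ hq hne
    rw [Finset.HasAntidiagonal.mem_antidiagonal] at hq
    dsimp only at hq ⊢
    rcases Nat.eq_zero_or_pos a with rfl | ha
    · simp [h.zero_eq_zero]
    · have hb : b ≠ 0 := by rintro rfl; exact hne (by simp [← hq])
      rw [hL b (by omega), map_sum, ← Finset.sum_sub_distrib]
      exact Finset.sum_eq_zero fun r _ => by rw [hl a (by omega), sub_self]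
  · simp

/-- The logarithmic derivative of a sequence with the higher Leibniz rule consists of
derivations. -/
theorem leibniz_of_higher (h : IsLogDerivSeq l L) (B : A →ₗ[K] A →ₗ[K] A)
    (hL : ∀ m x y, L m (B x y) =
      ∑ q ∈ Finset.HasAntidiagonal.antidiagonal m, B (L q.1 x) (L q.2 y)) (n : ℕ) (x y : A) :
    l n (B x y) = B (l n x) y + B x (l n y) := by
  induction n using Nat.strong_induction_on generalizing x y with
  | _ n ih =>
    have := h.smul_leibniz_defect B n ih (fun m _ => hL m) x y
    rw [hL, sub_self, smul_zero] at this
    exact sub_eq_zero.1 this.symm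

/-- A sequence whose logarithmic derivative consists of derivations satisfies the higher Leibniz
rule. -/
theorem higher_of_leibniz [CharZero K] (h : IsLogDerivSeq l L) (B : A →ₗ[K] A →ₗ[K] A)
    (hl : ∀ m x y, l m (B x y) = B (l m x) y + B x (l m y)) (n : ℕ) (x y : A) :
    L n (B x y) = ∑ q ∈ Finset.HasAntidiagonal.antidiagonal n, B (L q.1 x) (L q.2 y) := by
  induction n using Nat.strong_induction_on generalizing x y with
  | _ n ih =>
    have := h.smul_leibniz_defect B n (fun m _ => hl m) ih x y
    rw [hl, sub_self, smul_eq_zero, sub_eq_zero] at this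
    rcases this with hn | hn
    · obtain rfl : n = 0 := by exact_mod_cast hn
      simp [h.zero_eq_id]
    · exact hn

end IsLogDerivSeq

theorem derivation_map_center {d : A →ₗ[K] A} (hd : ∀ x y, d (x * y) = d x * y + x * d y)
    {z : A} (hz : z ∈ Subalgebra.center K A) : d z ∈ Subalgebra.center K A := by
  rw [Subalgebra.mem_center_iff] at hz ⊢
  intro b
  have h := congrArg d (hz b)
  rw [hd, hd, hz (d b), add_comm] at h
  exact add_right_cancel h

/-- If all Lie derivations are standard, then all Lie higher derivations are proper. -/
theorem hasLHDProperty_of_lieDerivation_standard [CharZero K]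
    (H : ∀ L : A →ₗ[K] A, (∀ x y, L ⁅x, y⁆ = ⁅L x, y⁆ + ⁅x, L y⁆) →
      ∃ d τ : A →ₗ[K] A, (∀ x y, d (x * y) = d x * y + x * d y) ∧
        (∀ x, τ x ∈ Subalgebra.center K A) ∧ L = d + τ) : HasLHDProperty K A := by
  intro L hL
  let B : A →ₗ[K] A →ₗ[K] A := LinearMap.mul K A - (LinearMap.mul K A).flip
  have hl := isLogDerivSeq_logDerivSeq hL.zero_eq_id
  set l := logDerivSeq L
  have hlie : ∀ (n : ℕ) (x y : A), l n ⁅x, y⁆ = ⁅l n x, y⁆ + ⁅x, l n y⁆ :=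
    fun n x y => hl.leibniz_of_higher B hL.map_lie n x y
  have H' : ∀ n, ∃ d τ : A →ₗ[K] A, (∀ x y, d (x * y) = d x * y + x * d y) ∧
      (∀ x, τ x ∈ Subalgebra.center K A) ∧ l n = d + τ ∧ (n = 0 → d = 0) := by
    intro n
    rcases Nat.eq_zero_or_pos n with rfl | hn
    -- `δ 0 = 0` is forced here: `expSeq` needs it, and it keeps the inductions on `hrec` at lower
    -- indices.
    · exact ⟨0, 0, by simp, by simp, by simp [hl.zero_eq_zero], by simp⟩
    · obtain ⟨d, τ, h1, h2, h3⟩ := H (l n) (hlie n)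
      exact ⟨d, τ, h1, h2, h3, by omega⟩
  choose δ τ hδ hτ hs hδ0 using H'
  have hD := isLogDerivSeq_expSeq (hδ0 0 rfl)
  set D := expSeq δ
  -- `τ n` is a Lie derivation with central values, so both brackets in its Leibniz rule vanish.
  have hτc : ∀ (n : ℕ) (x y : A), τ n ⁅x, y⁆ = 0 := by
    intro n x y
    have h := hlie n x y
    have c : ∀ z w, z * τ n w = τ n w * z := fun z w =>
      Subalgebra.mem_center_iff.1 (hτ n w) z
    simp only [hs, LinearMap.add_apply, Ring.lie_def, map_sub, hδ, add_mul, mul_add, c] at h ⊢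
    rw [← sub_eq_zero] at h
    rw [← h]
    abel
  have hrec : ∀ (n : ℕ) (x : A), (n : K) • (L n - D n) x =
      ∑ q ∈ Finset.HasAntidiagonal.antidiagonal n,
        (δ q.1 ((L q.2 - D q.2) x) + τ q.1 (L q.2 x)) := by
    intro n x
    rw [LinearMap.sub_apply, smul_sub, hl.smul_eq_sum, hD.smul_eq_sum, ← Finset.sum_sub_distrib]
    refine Finset.sum_congr rfl fun q _ => ?_
    rw [hs, LinearMap.sub_apply, map_sub, LinearMap.add_apply]
    abel
  have hzero : L 0 - D 0 = 0 := by rw [hL.zero_eq_id, hD.zero_eq_id, sub_self]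
  have hcenter : ∀ n x, (L n - D n) x ∈ Subalgebra.center K A := by
    intro n
    induction n using Nat.strong_induction_on with
    | _ n ih =>
      intro x
      rcases Nat.eq_zero_or_pos n with rfl | hn
      · rw [hzero]; exact Subalgebra.zero_mem _
      · have hn' : (n : K) ≠ 0 := by exact_mod_cast hn.ne'
        rw [← inv_smul_smul₀ hn' ((L n - D n) x), hrec]
        refine Subalgebra.smul_mem _ (Subalgebra.sum_mem _ fun q hq => ?_) _
        refine Subalgebra.add_mem _ ?_ (hτ _ _)
        rcases Nat.eq_zero_or_pos q.1 with h0 | h0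
        · rw [hδ0 _ h0]; exact Subalgebra.zero_mem _
        · rw [Finset.HasAntidiagonal.mem_antidiagonal] at hq
          exact derivation_map_center (hδ _) (ih _ (by omega) x)
  have hcomm : ∀ (n : ℕ) (x y : A), (L n - D n) ⁅x, y⁆ = 0 := by
    intro n
    induction n using Nat.strong_induction_on with
    | _ n ih =>
      intro x y
      rcases Nat.eq_zero_or_pos n with rfl | hn
      · rw [hzero]; rfl
      · have hn' : (n : K) ≠ 0 := by exact_mod_cast hn.ne'
        refine (smul_eq_zero.1 ?_).resolve_left hn'
        rw [hrec]
        refine Finset.sum_eq_zero fun q hq => ?_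
        rw [hL.map_lie, map_sum, Finset.sum_eq_zero fun r _ => hτc _ _ _, add_zero]
        rcases Nat.eq_zero_or_pos q.1 with h0 | h0
        · rw [hδ0 _ h0]; rfl
        · rw [Finset.HasAntidiagonal.mem_antidiagonal] at hq
          rw [ih _ (by omega), map_zero]
  exact ⟨D, fun n => L n - D n,
    ⟨hD.zero_eq_id, fun k x y => hD.higher_of_leibniz (LinearMap.mul K A) hδ k x y⟩,
    sub_eq_zero.1 hzero, fun k _ => (add_sub_cancel (D k) (L k)).symm, fun k _ => hcenter k, fun k _ => hcomm k⟩

end LogarithmicDerivative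

/-! ### Bounded operators -/

theorem corollaryK8 {𝕜 : Type*} [RCLike 𝕜] {X : Type*} [NormedAddCommGroup X] [NormedSpace 𝕜 X]
    [CompleteSpace X] (hX : 2 ≤ Module.rank 𝕜 X) : HasLHDProperty 𝕜 (X →L[𝕜] X) := by
  apply hasLHDProperty_of_lieDerivation_standard
  have : Nontrivial X := by
    rw [← rank_pos_iff_nontrivial (R := 𝕜)]
    exact lt_of_lt_of_le (by norm_num) hX
  obtain ⟨v, hv⟩ := exists_ne (0 : X)
  obtain ⟨g, -, hg⟩ := exists_dual_vector 𝕜 v (norm_ne_zero_iff.2 hv)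
  have hgv : g v ≠ 0 := by rw [hg]; exact_mod_cast norm_ne_zero_iff.2 hv
  let f : X →L[𝕜] 𝕜 := (g v)⁻¹ • g
  have hf : f v = 1 := by simp [f, hgv]
  let φ : (X →L[𝕜] X) →ₗ[𝕜] 𝕜 :=
    { toFun := fun a => f (a v), map_add' := by simp, map_smul' := by simp }
  have hφ : ∀ a, φ a = f (a v) := fun a => rfl
  refine lieDerivation_standard two_ne_zero (p := f.smulRight v) (φ := φ) ?_ ?_ ?_ ?_
  · ext x; simp [hf]
  · intro a; ext x; simp [hφ, smul_smul, mul_comm]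
  · simp [hφ, hf]
  · intro s hs
    ext w
    -- Faithfulness: the rank-one operator `f.smulRight w` sends `v` to `w`.
    simpa [hf] using congrArg (fun T : X →L[𝕜] X => T v) (hs (f.smulRight w))
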